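/- Let $K_0(x)=\int_0^\infty e^{-x\cosh t}\,dt$ ($x>0$) be the modified Bessel function of the second kind and order zero, and for $n\in\mathbb{N}_0=\{0,1,2,\dots\}$ let \[ \tilde\omega_n(x):=\frac{(-x)^n K_0^{(n)}(x)}{n!}\qquad (x>0). \] Let $\delta_{i,j}$ denote the Kronecker delta and $\log$ the natural logarithm. Then each $\tilde\omega_n$ is infinitely differentiable on $(0,\infty)$, and its derivatives $\tilde\omega_n^{(m)}$ satisfy the following. 1. General estimate. There is a constant $\gamma\ge 1$ such that for all $n,m\in\mathbb{N}_0$ and all $x>0$ \[ \left|\tilde\omega_n^{(m)}(x)\right|\le m!\left(\frac{\gamma\sqrt{n+1}}{x}\right)^m\left(\frac{\delta_{m,0}}{\sqrt{2x+1}}+\frac{\gamma}{\sqrt{n+1}}\left(1+\delta_{m+n,0}\log\frac{x+1}{x}\right)\right). \] 2. Refined estimates for small and large arguments. (a) Small argument. For every $C>1$ there is a constant $\gamma>1$ (depending only on $C$) such that for all $n,m\in\mathbb{N}_0$ with \[ m\le\sqrt n\,\frac{C-1}{C}\qquad\text{and}\qquad 2\left\lfloor\frac{m\log(n+1)}{4\log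 2}\right\rfloor-2\le\frac{n-1}{2}, \] and all $x$ with $0<x\le\min\left\{\frac{n}{2C},\frac{n+1}{4\gamma}\right\}$, \[ \left|\tilde\omega_n^{(m)}(x)\right|\le m!\left(\frac{\gamma}{x}\right)^m\left(\frac{\delta_{m,0}}{\sqrt{2x+1}}+\frac{\gamma}{\sqrt{n+1}}\left(1+\delta_{n+m,0}\log\frac{x+1}{x}\right)\right). \] (b) Large argument. There is a constant $\gamma\ge 1$ such that for all $n,m\in\mathbb{N}_0$ with $m\ge 1+2\log(n+1)$ \[ \left|\tilde\omega_n^{(m)}(x)\right|\le m!\left(\frac{\gamma}{x}\right)^m\qquad\text{for all } x>\begin{cases}0, & n=0,1,\\ n+m(\sqrt n+2), & n\ge 2.\end{cases} \] 3. Exponential decay. For all $n\in\mathbb{N}_0$ and all $x\ge\max\{1,n+\sqrt n\}$ \[ \left|\tilde\omega_n(x)\right|\le 3\,\frac{\exp\left(\sqrt n-\frac{x}{1+\sqrt n}\right)}{\sqrt{n+1}}. \] -/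

import Mathlib

open scoped Nat ContDiff

/-- The modified Bessel function of the second kind and order zero on the positive half-line,
`K₀(x) = ∫₀^∞ exp(-x cosh t) dt` (the integral converges exactly for `x > 0`). -/
noncomputable def besselK0 (x : ℝ) : ℝ :=
  ∫ t in Set.Ioi (0 : ℝ), Real.exp (-x * Real.cosh t)

/-- `ω̃ₙ(x) = (-x)ⁿ K₀⁽ⁿ⁾(x) / n!`. -/
noncomputable def omegaTilde (n : ℕ) (x : ℝ) : ℝ :=
  (-x) ^ n * iteratedDeriv n besselK0 x / (n ! : ℝ)

/-- The real-valued Kronecker delta. -/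
def kroneckerDelta (i j : ℕ) : ℝ := if i = j then 1 else 0

open MeasureTheory Set Filter Topology

/-! Differentiating under the integral gives `omegaTilde n x` = ∫₀^∞ P(x cosh t) dt with the Poisson
weight P(y) = yⁿe^{-y}/n!, which has mass 1 and height O(1/√(n+1)). This yields ω̃ₙ = O(1/√(n+1))
for n ≥ 1, with a logarithm only for n = 0. All derivative bounds are Cauchy estimates, which differ
in the disc and in the holomorphic extension.

General case: the extension to the right half-plane loses only the factor (|z|/Re z)ⁿ
(`norm_omegaC_le`), which is bounded on discs about x of radius of order x/√n. Each derivative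
therefore costs √(n+1)/x.

Large x: the same discs lie beyond the mode y = n, where the Gaussian or exponential tail of P
absorbs the factor (n+1)^{m/2}.

Small x: with y = x cosh t the integral becomes ∫ P(y)(y² - x²)^{-1/2} dy over y > x. Moving its
path to the segment from z to 4x followed by a real half-line gives an extension bounded by
O(1/√(n+1)) on the disc of radius x/2, so no √n is lost. -/

/-! ### Holomorphic parameter integrals and Cauchy estimates. -/

/-- A dominated integral of holomorphic functions is holomorphic. -/
theorem differentiableOn_integral_of_dominated {α : Type*} [MeasurableSpace α] {μ : Measure α}
    {h : ℂ → α → ℂ} {U : Set ℂ} (hU : IsOpen U) {g : α → ℝ} (hg : Integrable g μ)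
    (hm : ∀ z ∈ U, AEStronglyMeasurable (h z) μ)
    (hd : ∀ᵐ a ∂μ, DifferentiableOn ℂ (fun z => h z a) U)
    (hb : ∀ᵐ a ∂μ, ∀ z ∈ U, ‖h z a‖ ≤ g a) :
    DifferentiableOn ℂ (fun z => ∫ a, h z a ∂μ) U := by
  intro z hz
  obtain ⟨ε, hε, hεU⟩ := Metric.isOpen_iff.1 hU z hz
  have hball : Metric.ball z (ε / 2) ⊆ U :=
    (Metric.ball_subset_ball (by linarith)).trans hεU
  have hsub : ∀ w ∈ Metric.ball z (ε / 2), Metric.closedBall w (ε / 4) ⊆ U := by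
    intro w hw v hv
    apply hεU
    rw [Metric.mem_ball] at *
    rw [Metric.mem_closedBall] at hv
    linarith [dist_triangle v w z]
  have hder : ∀ᵐ a ∂μ, ∀ w ∈ Metric.ball z (ε / 2),
      HasDerivAt (fun v => h v a) (deriv (fun v => h v a) w) w := by
    filter_upwards [hd] with a ha w hw
    exact (ha.differentiableAt (hU.mem_nhds (hball hw))).hasDerivAt
  have key := hasDerivAt_integral_of_dominated_loc_of_deriv_le (μ := μ) (F := h) (x₀ := z)
    (F' := fun w a => deriv (fun v => h v a) w) (bound := fun a => g a / (ε / 4))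
    (Metric.ball_mem_nhds z (half_pos hε))
    (eventually_of_mem (hU.mem_nhds hz) hm)
    (hg.mono' (hm z hz) (hb.mono fun a ha => ha z hz)) ?_ ?_ (hg.div_const _) hder
  · exact key.2.differentiableAt.differentiableWithinAt
  -- The derivative is measurable in the integration variable as a pointwise limit of difference
  -- quotients along `s k` → 0.
  · set s : ℕ → ℂ := fun k => ((ε / 4 / (k + 1) : ℝ) : ℂ) with hs
    have hspos : ∀ k : ℕ, 0 < ε / 4 / ((k : ℝ) + 1) := fun k => by positivity
    have hs0 : Tendsto s atTop (𝓝[≠] 0) := by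
      refine tendsto_nhdsWithin_iff.2 ⟨?_, Eventually.of_forall fun k => ?_⟩
      · have h1 : Tendsto (fun k : ℕ => ε / 4 / ((k : ℝ) + 1)) atTop (𝓝 0) := by
          have := (tendsto_one_div_add_atTop_nhds_zero_nat (𝕜 := ℝ)).const_mul (ε / 4)
          simpa [div_eq_mul_inv] using this
        exact (Complex.continuous_ofReal.tendsto' 0 0 Complex.ofReal_zero).comp h1
      · exact Complex.ofReal_ne_zero.2 (hspos k).ne'
    have hsU : ∀ k, z + s k ∈ U := by
      intro k
      apply hsub z (Metric.mem_ball_self (half_pos hε))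
      rw [Metric.mem_closedBall, dist_self_add_left, hs, Complex.norm_real, Real.norm_eq_abs,
        abs_of_pos (hspos k)]
      exact div_le_self (by positivity) (by linarith [k.cast_nonneg (α := ℝ)])
    refine aestronglyMeasurable_of_tendsto_ae atTop
      (f := fun k a => (s k)⁻¹ • (h (z + s k) a - h z a)) (fun k => ?_) ?_
    · exact ((hm _ (hsU k)).sub (hm z hz)).const_smul (s k)⁻¹
    · filter_upwards [hder] with a ha
      exact (ha z (Metric.mem_ball_self (half_pos hε))).tendsto_slope_zero.comp hs0
  -- Cauchy's estimate on circles of radius ε/4 turns the bound `g` into a bound for the derivative.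
  · filter_upwards [hd, hb] with a ha hba w hw
    refine Complex.norm_deriv_le_of_forall_mem_sphere_norm_le (by positivity) ?_ fun v hv => ?_
    · apply DifferentiableOn.diffContOnCl
      rw [closure_ball _ (by positivity)]
      exact ha.mono (hsub w hw)
    · exact hba v (hsub w hw (Metric.sphere_subset_closedBall hv))

theorem iteratedDeriv_eventuallyEq_re {F : ℂ → ℂ} {U : Set ℂ} (hU : IsOpen U)
    (hF : DifferentiableOn ℂ F U) {f : ℝ → ℝ} (hf : ∀ y : ℝ, (y : ℂ) ∈ U → f y = (F y).re)
    (m : ℕ) : ∀ y : ℝ, (y : ℂ) ∈ U → iteratedDeriv m f y = (iteratedDeriv m F y).re := by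
  induction m with
  | zero => simpa using hf
  | succ m ih =>
    intro y hy
    have hmem : ∀ᶠ v : ℝ in 𝓝 y, (v : ℂ) ∈ U :=
      Complex.continuous_ofReal.continuousAt.eventually_mem (hU.mem_nhds hy)
    have hd : DifferentiableAt ℂ (iteratedDeriv m F) y := by
      rw [iteratedDeriv_eq_iterate]
      exact ((hF.analyticOnNhd hU).iterated_deriv m _ hy).differentiableAt
    rw [iteratedDeriv_succ, iteratedDeriv_succ]
    have h1 : iteratedDeriv m f =ᶠ[𝓝 y] fun v : ℝ => (iteratedDeriv m F v).re :=
      hmem.mono fun v hv => ih v hv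
    rw [h1.deriv_eq]
    exact hd.hasDerivAt.real_of_complex.deriv

/-- Cauchy's estimate on the circle of radius R/2, so that control on the open ball suffices; the
lost 2^m goes into γ. -/
theorem abs_iteratedDeriv_le_of_holomorphic {F : ℂ → ℂ} {x R C : ℝ} (hR : 0 < R)
    (hF : DifferentiableOn ℂ F (Metric.ball (x : ℂ) R))
    (hC : ∀ z ∈ Metric.ball (x : ℂ) R, ‖F z‖ ≤ C) {f : ℝ → ℝ}
    (hf : ∀ y : ℝ, (y : ℂ) ∈ Metric.ball (x : ℂ) R → f y = (F y).re) (m : ℕ) :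
    |iteratedDeriv m f x| ≤ (m ! : ℝ) * C / (R / 2) ^ m := by
  rw [iteratedDeriv_eventuallyEq_re Metric.isOpen_ball hF hf m x (Metric.mem_ball_self hR)]
  refine (Complex.abs_re_le_norm _).trans ?_
  have hsub : Metric.closedBall (x : ℂ) (R / 2) ⊆ Metric.ball (x : ℂ) R :=
    Metric.closedBall_subset_ball (by linarith)
  refine Complex.norm_iteratedDeriv_le_of_forall_mem_sphere_norm_le m (by positivity) ?_
    fun v hv => hC v (hsub (Metric.sphere_subset_closedBall hv))
  apply DifferentiableOn.diffContOnCl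
  rw [closure_ball _ (by positivity)]
  exact hF.mono hsub

/-! ### Derivatives of K₀ and the extension of ω̃ₙ to the right half-plane. -/

theorem half_exp_le_cosh (t : ℝ) : Real.exp t / 2 ≤ Real.cosh t := by
  rw [Real.cosh_eq]; linarith [Real.exp_pos (-t)]

/-- One term of the exponential series, of degree n + 1, leaves a multiple of 1/cosh t ≤ 2e^{-t}. -/
theorem integrableOn_cosh_pow_mul_exp (n : ℕ) {δ : ℝ} (hδ : 0 < δ) (a : ℝ) :
    IntegrableOn (fun t => Real.cosh t ^ n * Real.exp (-(δ * Real.cosh t))) (Ioi a) := by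
  have h1 : IntegrableOn (fun t : ℝ => (((n + 1)! : ℝ) / δ ^ (n + 1) * 2) * Real.exp (-t)) (Ioi a) :=
    (integrableOn_exp_neg_Ioi a).const_mul _
  refine Integrable.mono' h1 (by fun_prop) (Eventually.of_forall fun t => ?_)
  have hc := Real.cosh_pos t
  rw [Real.norm_of_nonneg (by positivity)]
  have h2 := Real.pow_div_factorial_le_exp (x := δ * Real.cosh t) (by positivity) (n + 1)
  have h3 := half_exp_le_cosh t
  rw [Real.exp_neg, Real.exp_neg]
  have h4 : Real.cosh t ^ n * (Real.exp (δ * Real.cosh t))⁻¹ ≤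
      Real.cosh t ^ n * ((δ * Real.cosh t) ^ (n + 1) / ((n + 1)! : ℝ))⁻¹ := by gcongr
  refine h4.trans ?_
  have h5 : Real.cosh t ^ n * ((δ * Real.cosh t) ^ (n + 1) / ((n + 1)! : ℝ))⁻¹ =
      ((n + 1)! : ℝ) / δ ^ (n + 1) * (Real.cosh t)⁻¹ := by
    rw [mul_pow]
    field_simp
    rw [pow_succ]
  rw [h5, mul_assoc]
  gcongr
  calc (Real.cosh t)⁻¹ ≤ (Real.exp t / 2)⁻¹ := by gcongr
    _ = _ := by field_simp

/-- The `n`-th derivative of `K₀` on the right half-plane. -/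
noncomputable def besselKDeriv (n : ℕ) (z : ℂ) : ℂ :=
  ∫ t in Ioi (0 : ℝ), (-(Real.cosh t : ℂ)) ^ n * Complex.exp (-z * Real.cosh t)

theorem norm_besselKDeriv_integrand (n : ℕ) (z : ℂ) (t : ℝ) :
    ‖(-(Real.cosh t : ℂ)) ^ n * Complex.exp (-z * Real.cosh t)‖ =
      Real.cosh t ^ n * Real.exp (-(z.re * Real.cosh t)) := by
  rw [norm_mul, norm_pow, norm_neg, Complex.norm_real, Real.norm_of_nonneg (Real.cosh_pos t).le,
    Complex.norm_exp]
  congr 2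
  rw [Complex.mul_re, Complex.ofReal_re, Complex.ofReal_im]
  simp

theorem hasDerivAt_besselKDeriv (n : ℕ) {z : ℂ} (hz : 0 < z.re) :
    HasDerivAt (besselKDeriv n) (besselKDeriv (n + 1) z) z := by
  -- On this half-plane a single dominating function works for all `w`.
  have hU : {w : ℂ | z.re / 2 < w.re} ∈ 𝓝 z :=
    (isOpen_lt continuous_const Complex.continuous_re).mem_nhds (by simp; linarith)
  have hmeas : ∀ (k : ℕ) (w : ℂ), AEStronglyMeasurable
      (fun t : ℝ => (-(Real.cosh t : ℂ)) ^ k * Complex.exp (-w * Real.cosh t))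
      (volume.restrict (Ioi (0 : ℝ))) := by
    intro k w
    have hc : Continuous fun t : ℝ => ((Real.cosh t : ℝ) : ℂ) :=
      Complex.continuous_ofReal.comp Real.continuous_cosh
    exact (((hc.neg).pow k).mul (Complex.continuous_exp.comp
      (continuous_const.mul hc))).aestronglyMeasurable
  refine (hasDerivAt_integral_of_dominated_loc_of_deriv_le (μ := volume.restrict (Ioi (0 : ℝ)))
    (F := fun w t => (-(Real.cosh t : ℂ)) ^ n * Complex.exp (-w * Real.cosh t))
    (F' := fun w t => (-(Real.cosh t : ℂ)) ^ (n + 1) * Complex.exp (-w * Real.cosh t))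
    (bound := fun t => Real.cosh t ^ (n + 1) * Real.exp (-(z.re / 2 * Real.cosh t)))
    hU (Eventually.of_forall fun w => hmeas n w) ?_ (hmeas _ z) ?_
    (integrableOn_cosh_pow_mul_exp (n + 1) (half_pos hz) 0) ?_).2
  · refine Integrable.mono' (integrableOn_cosh_pow_mul_exp n hz 0) (hmeas n z)
      (Eventually.of_forall fun t => ?_)
    rw [norm_besselKDeriv_integrand]
  · refine Eventually.of_forall fun t w hw => ?_
    rw [norm_besselKDeriv_integrand]
    have := Real.cosh_pos t
    gcongr
    exact le_of_lt hw
  · refine Eventually.of_forall fun t w _ => ?_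
    have h1 : HasDerivAt (fun w : ℂ => -w * (Real.cosh t : ℂ)) (-(Real.cosh t : ℂ)) w := by
      simpa using ((hasDerivAt_id w).neg).mul_const (Real.cosh t : ℂ)
    refine ((h1.cexp).const_mul ((-(Real.cosh t : ℂ)) ^ n)).congr_deriv ?_
    ring

theorem besselKDeriv_ofReal (n : ℕ) (x : ℝ) : besselKDeriv n (x : ℂ) =
    ((∫ t in Ioi (0 : ℝ), (-Real.cosh t) ^ n * Real.exp (-x * Real.cosh t) : ℝ) : ℂ) := by
  rw [besselKDeriv, ← integral_complex_ofReal]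
  congr 1
  ext t
  push_cast
  rfl

theorem iteratedDeriv_besselK0 (n : ℕ) {x : ℝ} (hx : 0 < x) :
    iteratedDeriv n besselK0 x =
      ∫ t in Ioi (0 : ℝ), (-Real.cosh t) ^ n * Real.exp (-x * Real.cosh t) := by
  suffices h : ∀ x : ℝ, 0 < x → iteratedDeriv n besselK0 x = (besselKDeriv n x).re by
    rw [h x hx, besselKDeriv_ofReal, Complex.ofReal_re]
  clear hx
  induction n with
  | zero =>
    intro x _
    rw [besselKDeriv_ofReal, Complex.ofReal_re]
    simp [besselK0]
  | succ n ih =>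
    intro x hx
    rw [iteratedDeriv_succ]
    have h1 : iteratedDeriv n besselK0 =ᶠ[𝓝 x] fun y : ℝ => (besselKDeriv n y).re :=
      (lt_mem_nhds hx).mono fun y hy => ih y hy
    rw [h1.deriv_eq]
    exact (hasDerivAt_besselKDeriv n (z := (x : ℂ)) (by simpa using hx)).real_of_complex.deriv

/-- The extension of `ω̃ₙ` to the right half-plane. -/
noncomputable def omegaC (n : ℕ) (z : ℂ) : ℂ := (-z) ^ n * besselKDeriv n z / (n ! : ℂ)

theorem differentiableOn_omegaC (n : ℕ) : DifferentiableOn ℂ (omegaC n) {z | 0 < z.re} := by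
  intro z hz
  have h1 := (hasDerivAt_besselKDeriv n hz).differentiableAt
  have h2 : DifferentiableAt ℂ (fun z : ℂ => (-z) ^ n) z := by fun_prop
  exact ((h2.mul h1).div_const _).differentiableWithinAt

theorem omegaTilde_eq_re {n : ℕ} {x : ℝ} (hx : 0 < x) : omegaTilde n x = (omegaC n x).re := by
  rw [omegaTilde, omegaC, iteratedDeriv_besselK0 n hx, besselKDeriv_ofReal,
    ← Complex.ofReal_natCast, ← Complex.ofReal_neg, ← Complex.ofReal_pow, ← Complex.ofReal_mul,
    ← Complex.ofReal_div, Complex.ofReal_re]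

/-- The Poisson weight `yⁿ e^{-y} / n!`. -/
noncomputable def poissonWeight (n : ℕ) (y : ℝ) : ℝ := y ^ n * Real.exp (-y) / (n ! : ℝ)

theorem omegaTilde_eq_integral (n : ℕ) {x : ℝ} (hx : 0 < x) :
    omegaTilde n x = ∫ t in Ioi (0 : ℝ), poissonWeight n (x * Real.cosh t) := by
  rw [omegaTilde, iteratedDeriv_besselK0 n hx, ← integral_const_mul, ← integral_div]
  congr 1
  ext t
  rw [poissonWeight, ← mul_assoc, ← mul_pow, neg_mul_neg, neg_mul]

theorem poissonWeight_nonneg (n : ℕ) {y : ℝ} (hy : 0 ≤ y) : 0 ≤ poissonWeight n y := by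
  unfold poissonWeight; positivity

theorem continuous_poissonWeight (n : ℕ) : Continuous (poissonWeight n) := by
  unfold poissonWeight; fun_prop

theorem integrableOn_poissonWeight_cosh (n : ℕ) {x : ℝ} (hx : 0 < x) (a : ℝ) :
    IntegrableOn (fun t => poissonWeight n (x * Real.cosh t)) (Ioi a) := by
  have := ((integrableOn_cosh_pow_mul_exp n hx a).const_mul (x ^ n)).div_const (n ! : ℝ)
  refine this.congr (Eventually.of_forall fun t => ?_)
  simp only [poissonWeight, mul_pow]
  ring

theorem omegaTilde_nonneg (n : ℕ) {x : ℝ} (hx : 0 < x) : 0 ≤ omegaTilde n x := by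
  rw [omegaTilde_eq_integral n hx]
  refine integral_nonneg fun t => poissonWeight_nonneg n ?_
  have := Real.cosh_pos t
  positivity

/-- The exponential only sees Re z, whereas zⁿ contributes |z|ⁿ. The resulting ratio limits the size
of usable discs. -/
theorem norm_omegaC_le (n : ℕ) {z : ℂ} (hz : 0 < z.re) :
    ‖omegaC n z‖ ≤ (‖z‖ / z.re) ^ n * omegaTilde n z.re := by
  have h1 : ‖besselKDeriv n z‖ ≤
      ∫ t in Ioi (0 : ℝ), Real.cosh t ^ n * Real.exp (-(z.re * Real.cosh t)) := by
    refine (norm_integral_le_integral_norm _).trans_eq ?_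
    simp_rw [norm_besselKDeriv_integrand]
  have h2 : (‖z‖ / z.re) ^ n * omegaTilde n z.re = ‖z‖ ^ n *
      (∫ t in Ioi (0 : ℝ), Real.cosh t ^ n * Real.exp (-(z.re * Real.cosh t))) / (n ! : ℝ) := by
    rw [omegaTilde_eq_integral n hz]
    simp only [poissonWeight, mul_pow, mul_assoc]
    rw [integral_div, integral_const_mul, div_pow]
    field_simp
  rw [h2, omegaC, norm_div, norm_mul, norm_pow, norm_neg, Complex.norm_natCast]
  gcongr

theorem contDiffOn_omegaTilde (n : ℕ) : ContDiffOn ℝ ∞ (omegaTilde n) (Ioi 0) := by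
  have hopen : IsOpen {z : ℂ | 0 < z.re} := isOpen_lt continuous_const Complex.continuous_re
  have h1 : ContDiffOn ℂ ∞ (omegaC n) {z | 0 < z.re} :=
    (differentiableOn_omegaC n).contDiffOn hopen
  have h2 : ContDiffOn ℝ ∞ (fun x : ℝ => (omegaC n x).re) (Ioi 0) :=
    Complex.reCLM.contDiff.comp_contDiffOn ((h1.restrict_scalars ℝ).comp
      Complex.ofRealCLM.contDiff.contDiffOn fun x hx => by simpa using hx)
  exact h2.congr fun x hx => omegaTilde_eq_re hx

/-! ### Height and mass of the Poisson weight. -/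

theorem poissonWeight_le_one (n : ℕ) {y : ℝ} (hy : 0 ≤ y) :
    poissonWeight n y ≤ 1 := by
  rw [poissonWeight, mul_div_right_comm, Real.exp_neg, ← div_eq_mul_inv,
    div_le_one (Real.exp_pos _)]
  exact Real.pow_div_factorial_le_exp y hy n

/-- The maximum is at y = n; it follows from u ≤ e^{u-1} at u = y/n. -/
theorem pow_mul_exp_neg_le (n : ℕ) {y : ℝ} (hy : 0 ≤ y) :
    y ^ n * Real.exp (-y) ≤ (n / Real.exp 1) ^ n := by
  rcases Nat.eq_zero_or_pos n with rfl | hn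
  · simpa using hy
  have hn' : (0 : ℝ) < n := by exact_mod_cast hn
  have h1 : y / n ≤ Real.exp (y / n - 1) := by
    have := Real.add_one_le_exp (y / n - 1); linarith
  have h2 : y ^ n ≤ (n * Real.exp (y / n - 1)) ^ n := by
    apply pow_le_pow_left₀ hy
    rw [div_le_iff₀ hn'] at h1
    linarith
  calc y ^ n * Real.exp (-y) ≤ (n * Real.exp (y / n - 1)) ^ n * Real.exp (-y) := by gcongr
    _ = (n / Real.exp 1) ^ n := by
      rw [div_pow, mul_pow, ← Real.exp_nat_mul, ← Real.exp_nat_mul, mul_assoc, ← Real.exp_add,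
        div_eq_mul_inv (_ ^ n), ← Real.exp_neg]
      congr 2
      field_simp
      ring

theorem poissonWeight_le (n : ℕ) {y : ℝ} (hy : 0 ≤ y) :
    poissonWeight n y ≤ 1 / √((n : ℝ) + 1) := by
  rcases Nat.eq_zero_or_pos n with rfl | hn
  · simpa using poissonWeight_le_one 0 hy
  have hn' : (1 : ℝ) ≤ n := by exact_mod_cast hn
  have h1 := Stirling.le_factorial_stirling n
  have h2 := pow_mul_exp_neg_le n hy
  have h3 : √((n : ℝ) + 1) ≤ √(2 * Real.pi * n) := by
    apply Real.sqrt_le_sqrt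
    nlinarith [Real.pi_gt_three]
  rw [poissonWeight, div_le_div_iff₀ (by positivity) (by positivity), one_mul]
  calc y ^ n * Real.exp (-y) * √((n : ℝ) + 1)
      ≤ (n / Real.exp 1) ^ n * √(2 * Real.pi * n) := by gcongr
    _ ≤ n ! := by rw [mul_comm]; exact h1

theorem integral_poissonWeight_Ioi_le (n : ℕ) {a : ℝ} (ha : 0 ≤ a) :
    ∫ y in Ioi a, poissonWeight n y ≤ 1 := by
  have h0 : IntegrableOn (fun y : ℝ => poissonWeight n y) (Ioi 0) ∧
      ∫ y in Ioi (0 : ℝ), poissonWeight n y = 1 := by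
    have h1 := Real.GammaIntegral_convergent (s := (n : ℝ) + 1) (by positivity)
    have h2 := Real.Gamma_eq_integral (s := (n : ℝ) + 1) (by positivity)
    have h3 : ∀ y : ℝ, Real.exp (-y) * y ^ ((n : ℝ) + 1 - 1) / (n ! : ℝ) = poissonWeight n y := by
      intro y
      rw [poissonWeight, add_sub_cancel_right, Real.rpow_natCast, mul_comm]
    constructor
    · refine (h1.div_const (n ! : ℝ)).congr (Eventually.of_forall fun y => h3 y)
    · simp_rw [← h3]
      rw [integral_div, ← h2, Real.Gamma_nat_eq_factorial, div_self (by positivity)]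
  rw [← h0.2]
  refine setIntegral_mono_set h0.1 ?_ (Ioi_subset_Ioi ha).eventuallyLE
  exact (ae_restrict_mem measurableSet_Ioi).mono fun y hy => poissonWeight_nonneg n (le_of_lt hy)

theorem integrableOn_poissonWeight (n : ℕ) {a : ℝ} (ha : 0 ≤ a) :
    IntegrableOn (poissonWeight n) (Ioi a) := by
  have h1 := Real.GammaIntegral_convergent (s := (n : ℝ) + 1) (by positivity)
  refine IntegrableOn.mono_set ?_ (Ioi_subset_Ioi ha)
  refine (h1.div_const (n ! : ℝ)).congr (Eventually.of_forall fun y => ?_)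
  simp only [poissonWeight, add_sub_cancel_right, Real.rpow_natCast, mul_comm]

/-! ### The substitution y = x cosh t and uniform bounds for ω̃ₙ. -/

theorem image_mul_cosh_Ioi {x a : ℝ} (hx : 0 < x) (ha : 0 ≤ a) :
    (fun t => x * Real.cosh t) '' Ioi a = Ioi (x * Real.cosh a) := by
  have hmono : ∀ s t : ℝ, 0 ≤ s → s < t → Real.cosh s < Real.cosh t := fun s t hs hst => by
    rw [Real.cosh_lt_cosh, abs_of_nonneg hs, abs_of_nonneg (hs.trans hst.le)]; exact hst
  ext y
  simp only [mem_image, mem_Ioi]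
  constructor
  · rintro ⟨t, ht, rfl⟩
    exact mul_lt_mul_of_pos_left (hmono a t ha ht) hx
  · intro hy
    have h1 : Real.cosh a < y / x := by rw [lt_div_iff₀ hx]; linarith
    have h2 : 1 ≤ y / x := (Real.one_le_cosh a).trans h1.le
    refine ⟨Real.arcosh (y / x), ?_, ?_⟩
    · by_contra! h
      rcases h.lt_or_eq with h | h
      · have := hmono _ _ (Real.arcosh_nonneg h2) h
        rw [Real.cosh_arcosh h2] at this
        linarith
      · rw [← h, Real.cosh_arcosh h2] at h1
        exact lt_irrefl _ h1
    · rw [Real.cosh_arcosh h2]; field_simp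

theorem injOn_mul_cosh {x a : ℝ} (hx : 0 < x) (ha : 0 ≤ a) :
    InjOn (fun t => x * Real.cosh t) (Ioi a) := fun _ hs _ ht h =>
  Real.cosh_injOn (ha.trans (le_of_lt hs)) (ha.trans (le_of_lt ht)) (mul_left_cancel₀ hx.ne' h)

theorem hasDerivWithinAt_mul_cosh (x : ℝ) (s : Set ℝ) (t : ℝ) :
    HasDerivWithinAt (fun t => x * Real.cosh t) (x * Real.sinh t) s t :=
  ((Real.hasDerivAt_cosh t).const_mul x).hasDerivWithinAt

theorem setIntegral_mul_cosh {x a : ℝ} (hx : 0 < x) (ha : 0 ≤ a) (g : ℝ → ℝ) :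
    ∫ y in Ioi (x * Real.cosh a), g y =
      ∫ t in Ioi a, x * Real.sinh t * g (x * Real.cosh t) := by
  rw [← image_mul_cosh_Ioi hx ha, integral_image_eq_integral_abs_deriv_smul measurableSet_Ioi
    (fun t _ => hasDerivWithinAt_mul_cosh x _ t) (injOn_mul_cosh hx ha)]
  refine setIntegral_congr_fun measurableSet_Ioi fun t ht => ?_
  have : 0 ≤ Real.sinh t := Real.sinh_nonneg_iff.2 (ha.trans (le_of_lt ht))
  simp only [smul_eq_mul]
  rw [abs_of_nonneg (by positivity)]

theorem integrableOn_mul_cosh_iff {x a : ℝ} (hx : 0 < x) (ha : 0 ≤ a) (g : ℝ → ℝ) :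
    IntegrableOn g (Ioi (x * Real.cosh a)) ↔
      IntegrableOn (fun t => x * Real.sinh t * g (x * Real.cosh t)) (Ioi a) := by
  rw [← image_mul_cosh_Ioi hx ha, integrableOn_image_iff_integrableOn_abs_deriv_smul
    measurableSet_Ioi (fun t _ => hasDerivWithinAt_mul_cosh x _ t) (injOn_mul_cosh hx ha)]
  refine integrableOn_congr_fun (fun t ht => ?_) measurableSet_Ioi
  have : 0 ≤ Real.sinh t := Real.sinh_nonneg_iff.2 (ha.trans (le_of_lt ht))
  simp only [smul_eq_mul]
  rw [abs_of_nonneg (by positivity)]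

theorem poissonWeight_succ (n : ℕ) (y : ℝ) :
    poissonWeight (n + 1) y = y / ((n : ℝ) + 1) * poissonWeight n y := by
  simp only [poissonWeight, Nat.factorial_succ]
  push_cast
  field_simp
  ring

theorem cosh_le_two_mul_sinh {t : ℝ} (ht : 1 ≤ t) : Real.cosh t ≤ 2 * Real.sinh t := by
  have h1 : Real.sinh 1 ≤ Real.sinh t := Real.sinh_le_sinh.2 ht
  have h2 : (1 : ℝ) ≤ Real.sinh 1 := Real.self_le_sinh_iff.2 zero_le_one
  have h3 := Real.cosh_sq t
  nlinarith [Real.cosh_pos t]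

/-- The uniform bound for `ω̃ₙ`, `n ≥ 1`. -/
theorem omegaTilde_succ_le (n : ℕ) {x : ℝ} (hx : 0 < x) :
    omegaTilde (n + 1) x ≤ 5 / √((n : ℝ) + 2) := by
  rw [omegaTilde_eq_integral _ hx]
  have hint := integrableOn_poissonWeight_cosh (n + 1) hx 0
  rw [← Ioc_union_Ioi_eq_Ioi (zero_le_one (α := ℝ)), setIntegral_union
    (by simp) measurableSet_Ioi (hint.mono_set Ioc_subset_Ioi_self)
    (hint.mono_set (Ioi_subset_Ioi zero_le_one))]
  -- Near t = 0, where dy = x sinh t dt degenerates, the height of the weight is used on an interval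
  -- of length one.
  have h1 : ∫ t in Ioc (0 : ℝ) 1, poissonWeight (n + 1) (x * Real.cosh t) ≤
      1 / √((n : ℝ) + 2) := by
    have := setIntegral_mono_on (hint.mono_set Ioc_subset_Ioi_self)
      (integrableOn_const (C := 1 / √((n : ℝ) + 2)) (by simp)) measurableSet_Ioc
      (fun t _ => ?_) (s := Ioc (0 : ℝ) 1)
    · simpa using this
    · have := poissonWeight_le (n + 1) (y := x * Real.cosh t)
        (mul_nonneg hx.le (Real.cosh_pos t).le)
      push_cast at this
      rwa [add_assoc, one_add_one_eq_two] at this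
  -- For t ≥ 1 the factor y/(n+1) from `poissonWeight_succ` supplies the Jacobian, as cosh t ≤ 2
  -- sinh t; what remains is mass at most one.
  have h2 : ∫ t in Ioi (1 : ℝ), poissonWeight (n + 1) (x * Real.cosh t) ≤
      2 / ((n : ℝ) + 1) := by
    have h3 : IntegrableOn (fun t => x * Real.sinh t * poissonWeight n (x * Real.cosh t))
        (Ioi 1) := (integrableOn_mul_cosh_iff hx zero_le_one _).1
      (integrableOn_poissonWeight n (mul_nonneg hx.le (Real.cosh_pos 1).le))
    calc ∫ t in Ioi (1 : ℝ), poissonWeight (n + 1) (x * Real.cosh t)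
        ≤ ∫ t in Ioi (1 : ℝ), 2 / ((n : ℝ) + 1) *
            (x * Real.sinh t * poissonWeight n (x * Real.cosh t)) := by
          refine setIntegral_mono_on (hint.mono_set (Ioi_subset_Ioi zero_le_one))
            (h3.const_mul _) measurableSet_Ioi fun t ht => ?_
          rw [poissonWeight_succ]
          have h4 := cosh_le_two_mul_sinh (le_of_lt ht)
          have h5 := poissonWeight_nonneg n (y := x * Real.cosh t)
            (mul_nonneg hx.le (Real.cosh_pos t).le)
          calc x * Real.cosh t / ((n : ℝ) + 1) * poissonWeight n (x * Real.cosh t)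
              ≤ x * (2 * Real.sinh t) / ((n : ℝ) + 1) * poissonWeight n (x * Real.cosh t) := by
                gcongr
            _ = _ := by ring
      _ = 2 / ((n : ℝ) + 1) * ∫ y in Ioi (x * Real.cosh 1), poissonWeight n y := by
          rw [integral_const_mul, setIntegral_mul_cosh hx zero_le_one]
      _ ≤ 2 / ((n : ℝ) + 1) * 1 := by
          gcongr
          exact integral_poissonWeight_Ioi_le n (mul_nonneg hx.le (Real.cosh_pos 1).le)
      _ = _ := mul_one _
  have h6 : 2 / ((n : ℝ) + 1) ≤ 4 / √((n : ℝ) + 2) := by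
    rw [div_le_div_iff₀ (by positivity) (by positivity)]
    have : √((n : ℝ) + 2) ≤ (n : ℝ) + 2 := by
      rw [Real.sqrt_le_left (by positivity)]
      nlinarith [n.cast_nonneg (α := ℝ)]
    linarith [n.cast_nonneg (α := ℝ)]
  calc _ ≤ 1 / √((n : ℝ) + 2) + 4 / √((n : ℝ) + 2) := add_le_add h1 (h2.trans h6)
    _ = _ := by ring

theorem omegaTilde_le {n : ℕ} (hn : n ≠ 0) {x : ℝ} (hx : 0 < x) :
    omegaTilde n x ≤ 5 / √((n : ℝ) + 1) := by
  obtain ⟨k, rfl⟩ := Nat.exists_eq_succ_of_ne_zero hn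
  have := omegaTilde_succ_le k hx
  push_cast
  rwa [add_assoc, one_add_one_eq_two]

theorem omegaTilde_zero : omegaTilde 0 = besselK0 := by
  ext x; simp [omegaTilde]

theorem omegaTilde_zero_le {x : ℝ} (hx : 0 < x) :
    omegaTilde 0 x ≤ 2 + Real.log ((x + 1) / x) := by
  rw [omegaTilde_eq_integral _ hx]
  have hint := integrableOn_poissonWeight_cosh 0 hx 0
  -- Below this cut the integrand is at most 1; above it e^{-u} ≤ 1/u bounds the tail by (2/x)e^{-T}
  -- = 2/(x+1).
  set T := Real.log ((x + 1) / x) with hT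
  have h1x : 1 ≤ (x + 1) / x := by rw [le_div_iff₀ hx]; linarith
  have hT0 : 0 ≤ T := Real.log_nonneg h1x
  rw [← Ioc_union_Ioi_eq_Ioi hT0, setIntegral_union
    (by simp) measurableSet_Ioi (hint.mono_set Ioc_subset_Ioi_self)
    (hint.mono_set (Ioi_subset_Ioi hT0))]
  have h1 : ∫ t in Ioc (0 : ℝ) T, poissonWeight 0 (x * Real.cosh t) ≤ T := by
    have := setIntegral_mono_on (hint.mono_set Ioc_subset_Ioi_self)
      (integrableOn_const (C := (1 : ℝ)) (by simp)) measurableSet_Ioc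
      (fun t _ => poissonWeight_le_one 0 (mul_nonneg hx.le (Real.cosh_pos t).le))
      (s := Ioc (0 : ℝ) T)
    simpa [hT0] using this
  have h2 : ∫ t in Ioi T, poissonWeight 0 (x * Real.cosh t) ≤ 2 := by
    calc ∫ t in Ioi T, poissonWeight 0 (x * Real.cosh t)
        ≤ ∫ t in Ioi T, 2 / x * Real.exp (-t) := by
          refine setIntegral_mono_on (hint.mono_set (Ioi_subset_Ioi hT0))
            ((integrableOn_exp_neg_Ioi T).const_mul _) measurableSet_Ioi fun t _ => ?_
          have h3 := half_exp_le_cosh t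
          have h4 := Real.add_one_le_exp (x * Real.cosh t)
          have hc := Real.cosh_pos t
          simp only [poissonWeight, pow_zero, Nat.factorial_zero, Nat.cast_one, div_one, one_mul]
          rw [Real.exp_neg, Real.exp_neg]
          calc (Real.exp (x * Real.cosh t))⁻¹ ≤ (x * (Real.exp t / 2))⁻¹ := by
                apply inv_anti₀ (by positivity)
                nlinarith
            _ = _ := by field_simp
      _ = 2 / x * (x / (x + 1)) := by
          rw [integral_const_mul, integral_exp_neg_Ioi, hT, Real.exp_neg,
            Real.exp_log (by positivity), inv_div]
      _ ≤ 2 := by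
          rw [div_mul_div_cancel₀ hx.ne', div_le_iff₀ (by positivity)]
          linarith
  linarith

/-! ### Laplace-type bound beyond the mode. -/

theorem cosh_sub_one_ge (t : ℝ) : t ^ 2 / 2 ≤ Real.cosh t - 1 := by
  have h1 := Real.cosh_two_mul (t / 2)
  have h2 := Real.cosh_sq (t / 2)
  have h3 : (t / 2) ^ 2 ≤ Real.sinh (t / 2) ^ 2 := by
    rw [sq_le_sq]
    rcases le_total 0 t with h | h
    · have := Real.self_le_sinh_iff.2 (by linarith : 0 ≤ t / 2)
      rwa [abs_of_nonneg (by linarith), abs_of_nonneg (by linarith)]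
    · have := Real.sinh_le_self_iff.2 (by linarith : t / 2 ≤ 0)
      rw [abs_of_nonpos (by linarith), abs_of_nonpos (by linarith)]
      linarith
  rw [mul_div_cancel₀ t two_ne_zero] at h1
  nlinarith

/-- Since coshⁿ t ≤ e^{n(cosh t - 1)}, the integrand is at most P(y) e^{-(y-n)(cosh t - 1)}; then
cosh t - 1 ≥ t²/2 leaves a Gaussian integral. -/
theorem omegaTilde_le_poissonWeight_mul_sqrt (n : ℕ) {y : ℝ} (hy : (n : ℝ) < y) :
    omegaTilde n y ≤ poissonWeight n y * √(Real.pi / (2 * (y - n))) := by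
  have hy0 : 0 < y := n.cast_nonneg.trans_lt hy
  have hb : 0 < (y - n) / 2 := by linarith
  rw [omegaTilde_eq_integral n hy0]
  calc ∫ t in Ioi (0 : ℝ), poissonWeight n (y * Real.cosh t)
      ≤ ∫ t in Ioi (0 : ℝ), poissonWeight n y * Real.exp (-((y - n) / 2) * t ^ 2) := by
        refine setIntegral_mono_on (integrableOn_poissonWeight_cosh n hy0 0)
          ((integrable_exp_neg_mul_sq hb).integrableOn.const_mul _) measurableSet_Ioi
          fun t _ => ?_
        have hc := Real.cosh_pos t
        have h1 : Real.cosh t ^ n ≤ Real.exp (n * (Real.cosh t - 1)) := by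
          rw [Real.exp_nat_mul]
          apply pow_le_pow_left₀ hc.le
          have := Real.add_one_le_exp (Real.cosh t - 1)
          linarith
        have h2 : y ^ n * Real.cosh t ^ n * Real.exp (-(y * Real.cosh t)) ≤
            y ^ n * Real.exp (-y) * Real.exp (-((y - n) / 2) * t ^ 2) := by
          calc y ^ n * Real.cosh t ^ n * Real.exp (-(y * Real.cosh t))
              ≤ y ^ n * Real.exp (n * (Real.cosh t - 1)) * Real.exp (-(y * Real.cosh t)) := by
                gcongr
            _ = y ^ n * Real.exp (-y + (-(y - n) * (Real.cosh t - 1))) := by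
                rw [mul_assoc, ← Real.exp_add]
                congr 2
                ring
            _ ≤ y ^ n * Real.exp (-y + -((y - n) / 2) * t ^ 2) := by
                refine mul_le_mul_of_nonneg_left (Real.exp_le_exp.2 ?_) (by positivity)
                nlinarith [cosh_sub_one_ge t]
            _ = _ := by rw [Real.exp_add, mul_assoc]
        simp only [poissonWeight]
        rw [mul_pow, div_mul_eq_mul_div]
        exact div_le_div_of_nonneg_right h2 (by positivity)
    _ = poissonWeight n y * √(Real.pi / (2 * (y - n))) := by
        rw [integral_const_mul, integral_gaussian_Ioi]
        congr 1
        rw [div_eq_iff two_ne_zero, ← Real.sqrt_sq (zero_le_two (α := ℝ)),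
          ← Real.sqrt_mul' _ (by positivity), Real.sqrt_sq zero_le_two]
        congr 1
        have : y - n ≠ 0 := by linarith
        field_simp

/-! ### General estimate, from discs of radius of order x/√n. -/

theorem re_mem_of_mem_ball {x R : ℝ} {z : ℂ} (hz : z ∈ Metric.ball (x : ℂ) R) :
    |z.re - x| < R ∧ (z.re - x) ^ 2 + z.im ^ 2 < R ^ 2 := by
  rw [Metric.mem_ball, dist_eq_norm] at hz
  have h1 : |z.re - x| ≤ ‖z - x‖ := by simpa using Complex.abs_re_le_norm (z - x)
  refine ⟨h1.trans_lt hz, ?_⟩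
  have h2 : (z.re - x) ^ 2 + z.im ^ 2 = ‖z - x‖ ^ 2 := by
    rw [← Complex.normSq_eq_norm_sq, Complex.normSq_apply]
    simp
    ring
  rw [h2]
  gcongr

/-- Seen from the origin the disc has half-angle arcsin r, so (Re z/|z|)² ≥ 1 - r². Bernoulli gives
(1 - r²)ⁿ ≥ 1 - nr² ≥ 1/4. -/
theorem norm_pow_le_of_mem_ball {n : ℕ} {x r : ℝ} (hx : 0 < x) (hr : 0 < r) (hr1 : r < 1)
    (hrn : n * r ^ 2 ≤ 3 / 4) {z : ℂ} (hz : z ∈ Metric.ball (x : ℂ) (r * x)) :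
    (‖z‖ / z.re) ^ n ≤ 2 := by
  obtain ⟨h1, h2⟩ := re_mem_of_mem_ball hz
  rw [abs_lt] at h1
  have hre : 0 < z.re := by nlinarith
  have hr2 : r ^ 2 < 1 := by nlinarith
  have h3 : (1 - r ^ 2) * ‖z‖ ^ 2 ≤ z.re ^ 2 := by
    rw [← Complex.normSq_eq_norm_sq, Complex.normSq_apply]
    -- The square vanishes at the points of tangency of lines through the origin, Re z = (1 - r²)x.
    nlinarith [sq_nonneg (z.re - x + r ^ 2 * x)]
  have h4 : 1 - n * r ^ 2 ≤ (1 - r ^ 2) ^ n := by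
    have := one_add_mul_le_pow (a := -r ^ 2) (by nlinarith) n
    calc 1 - n * r ^ 2 = 1 + n * (-r ^ 2) := by ring
      _ ≤ (1 + -r ^ 2) ^ n := this
      _ = _ := by ring
  have h5 : (1 - r ^ 2) * (‖z‖ / z.re) ^ 2 ≤ 1 := by
    rw [div_pow, ← mul_div_assoc, div_le_one (by positivity)]
    exact h3
  have h6 : (1 - r ^ 2) ^ n * ((‖z‖ / z.re) ^ n) ^ 2 ≤ 1 := by
    rw [← pow_mul, mul_comm n 2, pow_mul, ← mul_pow]
    exact pow_le_one₀ (mul_nonneg (by linarith) (sq_nonneg _)) h5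
  have h7 : 0 ≤ (‖z‖ / z.re) ^ n := by positivity
  nlinarith [sq_nonneg ((‖z‖ / z.re) ^ n)]

/-- Cauchy estimate for `ω̃ₙ` with relative radius `r ≲ n^{-1/2}`. -/
theorem abs_iteratedDeriv_omegaTilde_le {n : ℕ} {x r C : ℝ} (hx : 0 < x) (hr : 0 < r)
    (hr1 : r < 1) (hrn : n * r ^ 2 ≤ 3 / 4)
    (hC : ∀ y, (1 - r) * x < y → omegaTilde n y ≤ C) (m : ℕ) :
    |iteratedDeriv m (omegaTilde n) x| ≤ (m ! : ℝ) * (2 / r / x) ^ m * (2 * C) := by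
  have hre : ∀ z ∈ Metric.ball (x : ℂ) (r * x), (1 - r) * x < z.re ∧ 0 < z.re := by
    intro z hz
    have h1 := (abs_lt.1 (re_mem_of_mem_ball hz).1).1
    constructor <;> nlinarith
  refine (abs_iteratedDeriv_le_of_holomorphic (F := omegaC n) (R := r * x) (C := 2 * C)
    (by positivity) ((differentiableOn_omegaC n).mono fun z hz => (hre z hz).2)
    (fun z hz => ?_) (fun y hy => ?_) m).trans_eq ?_
  · obtain ⟨h1, h2⟩ := hre z hz
    refine (norm_omegaC_le n h2).trans ?_
    have h3 := norm_pow_le_of_mem_ball hx hr hr1 hrn hz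
    have h4 := omegaTilde_nonneg n h2
    exact mul_le_mul h3 (hC _ h1) h4 zero_le_two
  · exact omegaTilde_eq_re (by simpa using (hre _ hy).2)
  · rw [show (2 / r / x) ^ m = ((r * x / 2) ^ m)⁻¹ by rw [← inv_pow]; congr 1; field_simp]
    ring

/-- The relative radius used for the Cauchy estimates. -/
theorem radius_bounds (n : ℕ) :
    0 < 1 / (2 * (√(n : ℝ) + 2)) ∧ 1 / (2 * (√(n : ℝ) + 2)) < 1 ∧
      n * (1 / (2 * (√(n : ℝ) + 2))) ^ 2 ≤ 3 / 4 ∧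
      2 / (1 / (2 * (√(n : ℝ) + 2))) ≤ 12 * √((n : ℝ) + 1) := by
  have hs := Real.sqrt_nonneg (n : ℝ)
  have hs2 := Real.sq_sqrt (n.cast_nonneg (α := ℝ))
  refine ⟨by positivity, ?_, ?_, ?_⟩
  · rw [div_lt_one (by positivity)]; linarith
  · rw [one_div, inv_pow, ← div_eq_mul_inv, div_le_iff₀ (by positivity)]
    nlinarith
  · have h1 : √(n : ℝ) ≤ √((n : ℝ) + 1) := Real.sqrt_le_sqrt (by linarith)
    have h2 : 1 ≤ √((n : ℝ) + 1) := Real.one_le_sqrt.2 (by linarith [n.cast_nonneg (α := ℝ)])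
    rw [div_div_eq_mul_div, div_one]
    linarith

/-- As ω̃₀ = K₀ is unbounded at 0, a Cauchy estimate would bring in the logarithm. Its derivatives
are instead rescaled ω̃ₘ, uniformly bounded for m ≥ 1. -/
theorem abs_iteratedDeriv_omegaTilde_zero {m : ℕ} {x : ℝ} (hx : 0 < x) :
    |iteratedDeriv m (omegaTilde 0) x| = (m ! : ℝ) * (1 / x) ^ m * omegaTilde m x := by
  have h1 : |omegaTilde m x| = x ^ m * |iteratedDeriv m besselK0 x| / (m ! : ℝ) := by
    rw [omegaTilde, abs_div, abs_mul, abs_pow, abs_neg, abs_of_pos hx, Nat.abs_cast]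
  rw [← abs_of_nonneg (omegaTilde_nonneg m hx), h1, omegaTilde_zero,
    div_pow, one_pow]
  field_simp

theorem kroneckerDelta_nonneg (i j : ℕ) : 0 ≤ kroneckerDelta i j := by
  unfold kroneckerDelta; split_ifs <;> norm_num

theorem general_estimate_of_ne_zero {n m : ℕ} (h : n ≠ 0 ∨ m ≠ 0) {x : ℝ} (hx : 0 < x) :
    |iteratedDeriv m (omegaTilde n) x| ≤
      (m ! : ℝ) * (12 * √((n : ℝ) + 1) / x) ^ m * (10 / √((n : ℝ) + 1)) := by
  rcases Nat.eq_zero_or_pos n with rfl | hn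
  · have hm : m ≠ 0 := by simpa using h
    rw [abs_iteratedDeriv_omegaTilde_zero hx]
    have h1 := omegaTilde_le hm hx
    have h2 : 1 ≤ √((m : ℝ) + 1) := Real.one_le_sqrt.2 (by linarith [m.cast_nonneg (α := ℝ)])
    have h3 : omegaTilde m x ≤ 10 / √(((0 : ℕ) : ℝ) + 1) := by
      refine h1.trans ?_
      rw [div_le_iff₀ (by positivity)]
      norm_num
      linarith
    have := omegaTilde_nonneg m hx
    gcongr
    norm_num
  · obtain ⟨h1, h2, h3, h4⟩ := radius_bounds n
    refine (abs_iteratedDeriv_omegaTilde_le (C := 5 / √((n : ℝ) + 1)) hx h1 h2 h3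
      (fun y hy => omegaTilde_le hn.ne' (lt_trans (mul_pos (by linarith) hx) hy)) m).trans ?_
    rw [show 2 * (5 / √((n : ℝ) + 1)) = 10 / √((n : ℝ) + 1) by ring]
    gcongr

theorem log_div_nonneg {x : ℝ} (hx : 0 < x) : 0 ≤ Real.log ((x + 1) / x) :=
  Real.log_nonneg (by rw [le_div_iff₀ hx]; linarith)

theorem general_estimate (n m : ℕ) {x : ℝ} (hx : 0 < x) :
    |iteratedDeriv m (omegaTilde n) x| ≤
      (m ! : ℝ) * (12 * √((n : ℝ) + 1) / x) ^ m *
        (kroneckerDelta m 0 / √(2 * x + 1) +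
          12 / √((n : ℝ) + 1) *
            (1 + kroneckerDelta (m + n) 0 * Real.log ((x + 1) / x))) := by
  have hlog := log_div_nonneg hx
  have hk := kroneckerDelta_nonneg m 0
  by_cases h : n ≠ 0 ∨ m ≠ 0
  · refine (general_estimate_of_ne_zero h hx).trans ?_
    have hk2 := mul_nonneg (kroneckerDelta_nonneg (m + n) 0) hlog
    refine mul_le_mul_of_nonneg_left ?_ (by positivity)
    calc 10 / √((n : ℝ) + 1) ≤ 0 + 12 / √((n : ℝ) + 1) * (1 + 0) := by
          rw [add_zero, mul_one, zero_add]; gcongr; norm_num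
      _ ≤ _ := by gcongr; positivity
  · push Not at h
    obtain ⟨rfl, rfl⟩ := h
    have h1 := omegaTilde_zero_le hx
    rw [iteratedDeriv_zero, abs_of_nonneg (omegaTilde_nonneg 0 hx)]
    have h2 : 0 ≤ kroneckerDelta 0 0 / √(2 * x + 1) := by positivity
    have h3 : kroneckerDelta (0 + 0) 0 = 1 := if_pos rfl
    rw [h3, pow_zero, Nat.factorial_zero]
    have h4 : 0 ≤ (√(2 * x + 1))⁻¹ := by positivity
    norm_num
    linarith

/-! ### Large arguments: tails of the Poisson weight against (n+1)^{m/2}. -/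

/-- This is u ≤ sinh u at u = log s. -/
theorem log_le_half_sub_inv {s : ℝ} (hs : 1 ≤ s) : Real.log s ≤ (s - 1 / s) / 2 := by
  have h1 := Real.self_le_sinh_iff.2 (Real.log_nonneg hs)
  rwa [Real.sinh_log (by linarith), ← one_div] at h1

/-- With s = 1 + d/n, n(s - 1/s)/2 - d is exactly -d²/(2(n+d)): Gaussian decay for d ≤ n,
exponential for d ≥ n. -/
theorem poissonWeight_add_le (n : ℕ) (hn : n ≠ 0) {d : ℝ} (hd : 0 ≤ d) :
    poissonWeight n (n + d) ≤ Real.exp (-(d ^ 2 / (2 * (n + d)))) := by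
  have hn' : (0 : ℝ) < n := by exact_mod_cast Nat.pos_of_ne_zero hn
  have h0 := poissonWeight_le_one n (n.cast_nonneg (α := ℝ))
  have h1 : poissonWeight n (n + d) =
      poissonWeight n n * (((n + d) / n) ^ n * Real.exp (-d)) := by
    simp only [poissonWeight]
    rw [neg_add, Real.exp_add, div_pow]
    field_simp
  have h2 : ((n + d) / n) ^ n ≤ Real.exp (d - d ^ 2 / (2 * (n + d))) := by
    have hs : 1 ≤ (n + d) / n := by rw [le_div_iff₀ hn']; linarith
    have h3 := log_le_half_sub_inv hs
    rw [← Real.log_le_iff_le_exp (by positivity), Real.log_pow]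
    calc n * Real.log ((n + d) / n)
        ≤ n * (((n + d) / n - 1 / ((n + d) / n)) / 2) := by gcongr
      _ = d - d ^ 2 / (2 * (n + d)) := by field_simp; ring
  calc poissonWeight n (n + d)
      ≤ 1 * (Real.exp (d - d ^ 2 / (2 * (n + d))) * Real.exp (-d)) := by
        rw [h1]; gcongr
    _ = _ := by rw [one_mul, ← Real.exp_add]; congr 1; ring

/-- Tangent to log at 4, after log(n+1) ≤ 2 log(√n+1); its slope 1/4 makes the coefficient of √n
equal to one. -/
theorem two_mul_log_le_sqrt_add (n : ℕ) : 2 * Real.log ((n : ℝ) + 1) ≤ √(n : ℝ) + 5 := by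
  have hs := Real.sqrt_nonneg (n : ℝ)
  have hs2 := Real.sq_sqrt (n.cast_nonneg (α := ℝ))
  have h1 : Real.log ((n : ℝ) + 1) ≤ Real.log ((√(n : ℝ) + 1) ^ 2) :=
    Real.log_le_log (by positivity) (by nlinarith)
  rw [Real.log_pow] at h1
  have h2 := Real.log_le_sub_one_of_pos (x := (√(n : ℝ) + 1) / 4) (by positivity)
  rw [Real.log_div (by positivity) (by norm_num)] at h2
  have h3 : Real.log 4 ≤ 1.5 := by
    rw [show (4 : ℝ) = 2 ^ 2 by norm_num, Real.log_pow]
    have := Real.log_two_lt_d9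
    push_cast
    linarith
  push_cast at h1
  linarith

/-- The Gaussian decay of `ω̃ₙ` beats the factor `n^{m/2}`. -/
theorem sqrt_pow_mul_poissonWeight_le {n m : ℕ} (hn : n ≠ 0)
    (hm : 1 + 2 * Real.log ((n : ℝ) + 1) ≤ (m : ℝ)) {d : ℝ}
    (hd : ((m : ℝ) - 1) * √(n : ℝ) ≤ d) :
    √((n : ℝ) + 1) ^ m * poissonWeight n (n + d) ≤ 8 ^ m := by
  have hn' : (1 : ℝ) ≤ n := by exact_mod_cast Nat.one_le_iff_ne_zero.2 hn
  have hs := Real.sqrt_nonneg (n : ℝ)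
  have hs2 := Real.sq_sqrt (n.cast_nonneg (α := ℝ))
  set L := Real.log ((n : ℝ) + 1) with hL
  have hL0 : 0 ≤ L := Real.log_nonneg (by linarith)
  have hk : 0 ≤ (m : ℝ) - 1 := by linarith
  have hd0 : 0 ≤ d := (mul_nonneg hk hs).trans hd
  have h1 : √((n : ℝ) + 1) ^ m = Real.exp (m * (L / 2)) := by
    rw [Real.exp_nat_mul, hL, ← Real.log_sqrt (by positivity), Real.exp_log (by positivity)]
  have h2 : Real.exp 2 ≤ 8 := by
    have := Real.exp_one_lt_d9
    rw [show (2 : ℝ) = 1 + 1 by norm_num, Real.exp_add]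
    nlinarith [Real.exp_pos 1]
  have h3 : m * (L / 2) - d ^ 2 / (2 * (n + d)) ≤ m * 2 := by
    -- For d ≤ n the decay exponent is at least (m-1)²/4 ≥ (m-1)L/2. For d ≥ n it is at least d/4 ≥
    -- (m-1)√n/4, and √n ≥ 2L - 5. Either way at most L/2 + 5(m-1)/4 of mL/2 survives.
    rcases le_total d n with h | h
    · have h4 : ((m : ℝ) - 1) ^ 2 / 4 ≤ d ^ 2 / (2 * (n + d)) := by
        rw [div_le_div_iff₀ (by norm_num) (by positivity)]
        have h5 : ((m : ℝ) - 1) ^ 2 * n ≤ d ^ 2 := by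
          calc ((m : ℝ) - 1) ^ 2 * n = (((m : ℝ) - 1) * √(n : ℝ)) ^ 2 := by rw [mul_pow, hs2]
            _ ≤ d ^ 2 := by gcongr
        nlinarith [sq_nonneg ((m : ℝ) - 1)]
      nlinarith
    · have h4 : d / 4 ≤ d ^ 2 / (2 * (n + d)) := by
        rw [div_le_div_iff₀ (by norm_num) (by positivity)]
        nlinarith
      have h5 := two_mul_log_le_sqrt_add n
      rw [← hL] at h5
      have h6 : ((m : ℝ) - 1) * (2 * L) ≤ ((m : ℝ) - 1) * (√(n : ℝ) + 5) := by gcongr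
      nlinarith
  calc √((n : ℝ) + 1) ^ m * poissonWeight n (n + d)
      ≤ Real.exp (m * (L / 2)) * Real.exp (-(d ^ 2 / (2 * (n + d)))) := by
        rw [h1]
        exact mul_le_mul_of_nonneg_left (poissonWeight_add_le n hn hd0) (Real.exp_pos _).le
    _ = Real.exp (m * (L / 2) - d ^ 2 / (2 * (n + d))) := by
        rw [← Real.exp_add, ← sub_eq_add_neg]
    _ ≤ Real.exp (m * 2) := Real.exp_le_exp.2 h3
    _ = Real.exp 2 ^ m := Real.exp_nat_mul _ _
    _ ≤ 8 ^ m := by gcongr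

theorem large_argument_estimate {n m : ℕ} (hm : 1 + 2 * Real.log ((n : ℝ) + 1) ≤ (m : ℝ)) {x : ℝ}
    (hx : (if n ≤ 1 then 0 else (n : ℝ) + (m : ℝ) * (√(n : ℝ) + 2)) < x) :
    |iteratedDeriv m (omegaTilde n) x| ≤ (m ! : ℝ) * (400 / x) ^ m := by
  have hL0 : 0 ≤ Real.log ((n : ℝ) + 1) := Real.log_nonneg (by linarith [n.cast_nonneg (α := ℝ)])
  have hm1 : (1 : ℝ) ≤ m := by linarith
  have hm0 : m ≠ 0 := by rintro rfl; norm_num at hm1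
  split_ifs at hx with hn
  · refine (general_estimate_of_ne_zero (Or.inr hm0) hx).trans ?_
    have h1 : (1 : ℝ) ≤ √((n : ℝ) + 1) := Real.one_le_sqrt.2 (by linarith [n.cast_nonneg (α := ℝ)])
    have h2 : √((n : ℝ) + 1) ≤ 2 := by
      rw [Real.sqrt_le_left (by norm_num)]
      have : (n : ℝ) ≤ 1 := by exact_mod_cast hn
      linarith
    calc (m ! : ℝ) * (12 * √((n : ℝ) + 1) / x) ^ m * (10 / √((n : ℝ) + 1))
        ≤ (m ! : ℝ) * (12 * 2 / x) ^ m * 10 ^ m := by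
          gcongr
          calc 10 / √((n : ℝ) + 1) ≤ 10 := div_le_self (by norm_num) h1
            _ ≤ 10 ^ m := le_self_pow₀ (by norm_num) hm0
      _ = (m ! : ℝ) * (240 / x) ^ m := by rw [mul_assoc, ← mul_pow]; congr 2; ring
      _ ≤ _ := by gcongr; norm_num
  · have hn0 : n ≠ 0 := by omega
    have hs := Real.sqrt_nonneg (n : ℝ)
    have hs2 := Real.sq_sqrt (n.cast_nonneg (α := ℝ))
    have hx0 : 0 < x := lt_of_le_of_lt (by positivity) hx
    obtain ⟨h1, h2, h3, h4⟩ := radius_bounds n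
    set r := 1 / (2 * (√(n : ℝ) + 2)) with hr
    have hr2 : r * (√(n : ℝ) + 2) = 1 / 2 := by rw [hr]; field_simp
    have key : ∀ y, (1 - r) * x < y →
        omegaTilde n y ≤ 2 * (8 ^ m / √((n : ℝ) + 1) ^ m) := by
      intro y hy
      have h5 : (1 - r) * (n + m * (√(n : ℝ) + 2)) < y :=
        lt_trans (mul_lt_mul_of_pos_left hx (by linarith)) hy
      have h6 : r * n ≤ √(n : ℝ) / 2 := by nlinarith
      -- Passing to the left edge of the disc costs at most √n/2 + m/2 from the threshold; the spare
      -- 1 keeps 1/√(y - n) bounded.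
      have h7 : n + ((m : ℝ) - 1) * √(n : ℝ) + 1 ≤ y := by nlinarith
      have h8 : 0 ≤ ((m : ℝ) - 1) * √(n : ℝ) := mul_nonneg (by linarith) hs
      have h9 := omegaTilde_le_poissonWeight_mul_sqrt n (y := y) (by linarith)
      have h10 : √(Real.pi / (2 * (y - n))) ≤ 2 := by
        rw [Real.sqrt_le_left (by norm_num), div_le_iff₀ (by linarith)]
        linarith [Real.pi_lt_four]
      have h11 := sqrt_pow_mul_poissonWeight_le hn0 hm (d := y - n) (by linarith)
      rw [add_sub_cancel] at h11
      have h12 := poissonWeight_nonneg n (y := y) (by linarith [n.cast_nonneg (α := ℝ)])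
      have h13 : poissonWeight n y ≤ 8 ^ m / √((n : ℝ) + 1) ^ m := by
        rw [le_div_iff₀ (by positivity)]; linarith
      calc omegaTilde n y ≤ poissonWeight n y * 2 := h9.trans (by gcongr)
        _ ≤ _ := by linarith
    refine (abs_iteratedDeriv_omegaTilde_le hx0 h1 h2 h3 key m).trans ?_
    calc (m ! : ℝ) * (2 / r / x) ^ m * (2 * (2 * (8 ^ m / √((n : ℝ) + 1) ^ m)))
        ≤ (m ! : ℝ) * (12 * √((n : ℝ) + 1) / x) ^ m *
            (4 ^ m * (8 ^ m / √((n : ℝ) + 1) ^ m)) := by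
          rw [← mul_assoc 2 2, show (2 : ℝ) * 2 = 4 by norm_num]
          gcongr
          exact le_self_pow₀ (by norm_num) hm0
      -- 384 = 12·4·8, the powers of √(n+1) having cancelled.
      _ = (m ! : ℝ) * (384 / x) ^ m := by
          rw [mul_assoc, ← div_pow, ← mul_pow, ← mul_pow]
          congr 2
          field_simp
          norm_num
      _ ≤ _ := by gcongr; norm_num

/-! ### Exponential decay. -/

/-- Log-concavity: log P lies below its tangent at a. -/
theorem poissonWeight_le_of_le {n : ℕ} {a y : ℝ} (ha : 0 < a) (hy : a ≤ y) :
    poissonWeight n y ≤ poissonWeight n a * Real.exp (-((y - a) * (1 - n / a))) := by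
  have hy0 : 0 < y := ha.trans_le hy
  have h1 : (y / a) ^ n ≤ Real.exp (n * (y / a - 1)) := by
    rw [Real.exp_nat_mul]
    apply pow_le_pow_left₀ (by positivity)
    have := Real.add_one_le_exp (y / a - 1); linarith
  have h2 : poissonWeight n y = poissonWeight n a * ((y / a) ^ n * Real.exp (-(y - a))) := by
    simp only [poissonWeight]
    rw [neg_sub, Real.exp_sub, Real.exp_neg, Real.exp_neg, div_pow]
    field_simp
  rw [h2]
  refine mul_le_mul_of_nonneg_left ?_ (poissonWeight_nonneg n ha.le)
  calc (y / a) ^ n * Real.exp (-(y - a)) ≤ Real.exp (n * (y / a - 1)) * Real.exp (-(y - a)) := by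
        gcongr
    _ = _ := by
        rw [← Real.exp_add]
        congr 1
        field_simp
        ring

theorem exponential_decay (n : ℕ) {x : ℝ} (hx : max 1 ((n : ℝ) + √(n : ℝ)) ≤ x) :
    |omegaTilde n x| ≤
      3 * (Real.exp (√(n : ℝ) - x / (1 + √(n : ℝ))) / √((n : ℝ) + 1)) := by
  have hx1 : 1 ≤ x := (le_max_left _ _).trans hx
  have hx2 : (n : ℝ) + √(n : ℝ) ≤ x := (le_max_right _ _).trans hx
  have hs := Real.sqrt_nonneg (n : ℝ)
  have hs2 := Real.sq_sqrt (n.cast_nonneg (α := ℝ))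
  have hxn : 1 ≤ x - n := by
    rcases Nat.eq_zero_or_pos n with rfl | hn
    · simpa using hx1
    · have : 1 ≤ √(n : ℝ) := Real.one_le_sqrt.2 (by exact_mod_cast hn)
      linarith
  rw [abs_of_nonneg (omegaTilde_nonneg n (by linarith))]
  have h1 := omegaTilde_le_poissonWeight_mul_sqrt n (y := x) (by linarith)
  have h2 : √(Real.pi / (2 * (x - n))) ≤ 3 := by
    rw [Real.sqrt_le_left (by norm_num), div_le_iff₀ (by linarith)]
    linarith [Real.pi_lt_four]
  have h3 : poissonWeight n x ≤
      1 / √((n : ℝ) + 1) * Real.exp (√(n : ℝ) - x / (1 + √(n : ℝ))) := by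
    rcases Nat.eq_zero_or_pos n with rfl | hn
    · simp [poissonWeight]
    · have hn' : (0 : ℝ) < n := by exact_mod_cast hn
      have hsp : 0 < √(n : ℝ) := Real.sqrt_pos.2 hn'
      -- At a = n + √n the tangent slope is -1/(1+√n), the required rate, and a/(1+√n) = √n.
      refine (poissonWeight_le_of_le (a := n + √(n : ℝ)) (by positivity) hx2).trans ?_
      have h4 : -((x - (n + √(n : ℝ))) * (1 - n / (n + √(n : ℝ)))) =
          √(n : ℝ) - x / (1 + √(n : ℝ)) := by
        have h5 : (n : ℝ) + √(n : ℝ) = √(n : ℝ) * (1 + √(n : ℝ)) := by linarith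
        have h6 : 1 - n / (n + √(n : ℝ)) = 1 / (1 + √(n : ℝ)) := by
          rw [eq_div_iff (by positivity), h5]
          field_simp
          linarith
        rw [h6, h5]
        field_simp
        ring
      rw [h4]
      gcongr
      exact poissonWeight_le n (by positivity)
  have h7 := poissonWeight_nonneg n (y := x) (by linarith)
  calc omegaTilde n x ≤ poissonWeight n x * 3 := h1.trans (by gcongr)
    _ ≤ (1 / √((n : ℝ) + 1) * Real.exp (√(n : ℝ) - x / (1 + √(n : ℝ)))) * 3 := by gcongr
    _ = _ := by ring

/-! ### Small arguments: an extension to the disc of radius x/2. -/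

theorem image_add_sq_mul_Ioc {x Y : ℝ} (hY : x < Y) :
    (fun s : ℝ => x + s ^ 2 * (Y - x)) '' Ioc 0 1 = Ioc x Y := by
  have hd : 0 < Y - x := sub_pos.2 hY
  ext y
  simp only [mem_image, mem_Ioc]
  constructor
  · rintro ⟨s, ⟨h0, h1⟩, rfl⟩
    have h2 : s ^ 2 ≤ 1 := pow_le_one₀ h0.le h1
    have h3 : 0 < s ^ 2 * (Y - x) := by positivity
    constructor <;> nlinarith
  · rintro ⟨h0, h1⟩
    have h2 : 0 < (y - x) / (Y - x) := div_pos (by linarith) hd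
    refine ⟨√((y - x) / (Y - x)), ⟨Real.sqrt_pos.2 h2, ?_⟩, ?_⟩
    · rw [Real.sqrt_le_one, div_le_one hd]; linarith
    · rw [Real.sq_sqrt h2.le]; field_simp; ring

theorem setIntegral_add_sq_mul {x Y : ℝ} (hY : x < Y) (g : ℝ → ℝ) :
    ∫ y in Ioc x Y, g y =
      ∫ s in Ioc (0 : ℝ) 1, 2 * s * (Y - x) * g (x + s ^ 2 * (Y - x)) := by
  have hd : 0 < Y - x := sub_pos.2 hY
  rw [← image_add_sq_mul_Ioc hY, integral_image_eq_integral_abs_deriv_smul measurableSet_Ioc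
    (f' := fun s => 2 * s * (Y - x)) (fun s _ => ?_) (fun s hs t ht h => ?_)]
  · refine setIntegral_congr_fun measurableSet_Ioc fun s hs => ?_
    have := hs.1
    simp only [smul_eq_mul]
    rw [abs_of_nonneg (by positivity)]
  · have h1 := ((hasDerivAt_pow 2 s).mul_const (Y - x)).const_add x
    simpa using h1.hasDerivWithinAt
  · have h1 : s ^ 2 = t ^ 2 := mul_right_cancel₀ hd.ne' (add_left_cancel h)
    exact (pow_left_inj₀ hs.1.le ht.1.le two_ne_zero).1 h1

theorem rpow_neg_half {u : ℝ} (hu : 0 ≤ u) : u ^ (-(1 / 2) : ℝ) = (√u)⁻¹ := by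
  rw [Real.rpow_neg hu, ← Real.sqrt_eq_rpow]

/-- The substitution y = x + s²(Y - x) removes the inverse square root singularity at y = x, since
y² - x² = s²(Y-x)(2x + s²(Y-x)) and the Jacobian carries a factor s. It also fixes the range of
integration, so that x may become complex. -/
theorem omegaTilde_eq_add (n : ℕ) {x Y : ℝ} (hx : 0 < x) (hY : x < Y) :
    omegaTilde n x =
      (∫ s in Ioc (0 : ℝ) 1, 2 * poissonWeight n (x + s ^ 2 * (Y - x)) *
        ((Y - x) ^ (1 / 2 : ℝ) * (2 * x + s ^ 2 * (Y - x)) ^ (-(1 / 2) : ℝ))) +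
      ∫ y in Ioi Y, poissonWeight n y * (y ^ 2 - x ^ 2) ^ (-(1 / 2) : ℝ) := by
  have hd : 0 < Y - x := sub_pos.2 hY
  set g : ℝ → ℝ := fun y => poissonWeight n y * (y ^ 2 - x ^ 2) ^ (-(1 / 2) : ℝ) with hg
  have h1 : EqOn (fun t => poissonWeight n (x * Real.cosh t))
      (fun t => x * Real.sinh t * g (x * Real.cosh t)) (Ioi 0) := by
    intro t ht
    have hs : 0 < Real.sinh t := Real.sinh_pos_iff.2 ht
    have h2 : (x * Real.cosh t) ^ 2 - x ^ 2 = (x * Real.sinh t) ^ 2 := by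
      rw [mul_pow, Real.cosh_sq]; ring
    simp only [hg]
    rw [h2, rpow_neg_half (sq_nonneg _), Real.sqrt_sq (by positivity)]
    field_simp
  have h2 : omegaTilde n x = ∫ y in Ioi x, g y := by
    have := setIntegral_mul_cosh hx le_rfl g
    rw [Real.cosh_zero, mul_one] at this
    rw [this, omegaTilde_eq_integral n hx]
    exact setIntegral_congr_fun measurableSet_Ioi h1
  have h3 : IntegrableOn g (Ioi x) := by
    have := integrableOn_mul_cosh_iff hx le_rfl g
    rw [Real.cosh_zero, mul_one] at this
    rw [this]
    exact (integrableOn_poissonWeight_cosh n hx 0).congr_fun h1 measurableSet_Ioi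
  rw [h2, ← Ioc_union_Ioi_eq_Ioi hY.le, setIntegral_union (by simp) measurableSet_Ioi
    (h3.mono_set Ioc_subset_Ioi_self) (h3.mono_set (Ioi_subset_Ioi hY.le)),
    setIntegral_add_sq_mul hY]
  congr 1
  refine setIntegral_congr_fun measurableSet_Ioc fun s hs => ?_
  have hs0 := hs.1
  have h4 : (x + s ^ 2 * (Y - x)) ^ 2 - x ^ 2 =
      s ^ 2 * ((Y - x) * (2 * x + s ^ 2 * (Y - x))) := by ring
  have h5 : √(Y - x) ^ 2 = Y - x := Real.sq_sqrt hd.le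
  have h6 : 0 < √(Y - x) := Real.sqrt_pos.2 hd
  have h7 : 0 < √(2 * x + s ^ 2 * (Y - x)) := Real.sqrt_pos.2 (by positivity)
  simp only [hg]
  rw [h4, rpow_neg_half (by positivity), rpow_neg_half (by positivity), ← Real.sqrt_eq_rpow,
    Real.sqrt_mul (sq_nonneg s), Real.sqrt_sq hs0.le, Real.sqrt_mul hd.le]
  field_simp
  rw [h5, mul_comm]

/-- The integrand of the contribution of the segment from `z` to `Y` to `ω̃ₙ(z)`. -/
noncomputable def segmentIntegrand (n : ℕ) (Y : ℝ) (z : ℂ) (s : ℝ) : ℂ :=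
  2 * ((z + s ^ 2 * (Y - z)) ^ n * Complex.exp (-(z + s ^ 2 * (Y - z))) / (n ! : ℂ)) *
    ((Y - z) ^ ((1 / 2 : ℝ) : ℂ) * (2 * z + s ^ 2 * (Y - z)) ^ ((-(1 / 2) : ℝ) : ℂ))

/-- The integrand of the contribution of the half-line beyond `Y` to `ω̃ₙ(z)`. -/
noncomputable def tailIntegrand (n : ℕ) (z : ℂ) (y : ℝ) : ℂ :=
  (poissonWeight n y : ℂ) * ((y : ℂ) ^ 2 - z ^ 2) ^ ((-(1 / 2) : ℝ) : ℂ)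

theorem omegaTilde_eq_re_integral (n : ℕ) {x Y : ℝ} (hx : 0 < x) (hY : x < Y) :
    omegaTilde n x = ((∫ s in Ioc (0 : ℝ) 1, segmentIntegrand n Y x s) +
      ∫ y in Ioi Y, tailIntegrand n x y).re := by
  have hd : 0 < Y - x := sub_pos.2 hY
  have h1 : ∫ s in Ioc (0 : ℝ) 1, segmentIntegrand n Y x s =
      ∫ s in Ioc (0 : ℝ) 1, ((2 * poissonWeight n (x + s ^ 2 * (Y - x)) *
        ((Y - x) ^ (1 / 2 : ℝ) * (2 * x + s ^ 2 * (Y - x)) ^ (-(1 / 2) : ℝ)) : ℝ) : ℂ) := by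
    refine setIntegral_congr_fun measurableSet_Ioc fun s _ => ?_
    simp only [segmentIntegrand, poissonWeight]
    rw [Complex.ofReal_mul, Complex.ofReal_mul ((Y - x) ^ _), Complex.ofReal_cpow hd.le,
      Complex.ofReal_cpow (by positivity)]
    push_cast
    rfl
  have h2 : ∫ y in Ioi Y, tailIntegrand n x y =
      ∫ y in Ioi Y, ((poissonWeight n y * (y ^ 2 - x ^ 2) ^ (-(1 / 2) : ℝ) : ℝ) : ℂ) := by
    refine setIntegral_congr_fun measurableSet_Ioi fun y hy => ?_
    have hy' : Y < y := hy
    simp only [tailIntegrand]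
    rw [Complex.ofReal_mul, Complex.ofReal_cpow (by nlinarith)]
    push_cast
    rfl
  rw [h1, h2, integral_complex_ofReal, integral_complex_ofReal, ← Complex.ofReal_add,
    Complex.ofReal_re]
  exact omegaTilde_eq_add n hx hY

theorem geometry_of_mem_ball {x : ℝ} (hx : 0 < x) {z : ℂ}
    (hz : z ∈ Metric.ball (x : ℂ) (x / 2)) :
    x / 2 < z.re ∧ z.re < 3 / 2 * x ∧ ‖z‖ ≤ 3 / 2 * x ∧ ‖((4 * x : ℝ) : ℂ) - z‖ ≤ 4 * x := by
  have h1 := (re_mem_of_mem_ball hz).1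
  rw [abs_lt] at h1
  rw [Metric.mem_ball, dist_eq_norm] at hz
  refine ⟨by linarith, by linarith, ?_, ?_⟩
  · have h2 := norm_add_le (z - x) (x : ℂ)
    rw [sub_add_cancel, Complex.norm_real, Real.norm_of_nonneg hx.le] at h2
    linarith
  · have h2 := norm_sub_le ((3 * x : ℝ) : ℂ) (z - x)
    rw [Complex.norm_real, Real.norm_of_nonneg (by linarith)] at h2
    have h3 : ((4 * x : ℝ) : ℂ) - z = ((3 * x : ℝ) : ℂ) - (z - x) := by push_cast; ring
    rw [h3]
    linarith

theorem re_segment {z : ℂ} (a Y s : ℝ) :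
    ((a : ℂ) * z + (s : ℂ) ^ 2 * ((Y : ℂ) - z)).re = a * z.re + s ^ 2 * (Y - z.re) := by
  rw [← Complex.ofReal_pow, Complex.add_re, Complex.re_ofReal_mul, Complex.re_ofReal_mul,
    Complex.sub_re, Complex.ofReal_re]

theorem differentiableOn_segmentIntegrand (n : ℕ) {x : ℝ} (hx : 0 < x) (s : ℝ) :
    DifferentiableOn ℂ (fun z => segmentIntegrand n (4 * x) z s)
      (Metric.ball (x : ℂ) (x / 2)) := by
  intro z hz
  obtain ⟨h1, h2, -, -⟩ := geometry_of_mem_ball hx hz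
  have h3 : ((4 * x : ℝ) : ℂ) - z ∈ Complex.slitPlane := by
    left
    rw [Complex.sub_re, Complex.ofReal_re]
    linarith
  have h4 : 2 * z + (s : ℂ) ^ 2 * (((4 * x : ℝ) : ℂ) - z) ∈ Complex.slitPlane := by
    left
    have := re_segment (z := z) 2 (4 * x) s
    push_cast at this ⊢
    rw [this]
    nlinarith [sq_nonneg s]
  have h5 : DifferentiableAt ℂ (fun z : ℂ => (((4 * x : ℝ) : ℂ) - z) ^ ((1 / 2 : ℝ) : ℂ)) z :=
    DifferentiableAt.cpow_const (by fun_prop) h3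
  have h6 : DifferentiableAt ℂ (fun z : ℂ =>
      (2 * z + (s : ℂ) ^ 2 * (((4 * x : ℝ) : ℂ) - z)) ^ ((-(1 / 2) : ℝ) : ℂ)) z :=
    DifferentiableAt.cpow_const (by fun_prop) h4
  have h7 : DifferentiableAt ℂ (fun z : ℂ => 2 * ((z + (s : ℂ) ^ 2 * (((4 * x : ℝ) : ℂ) - z)) ^ n *
      Complex.exp (-(z + (s : ℂ) ^ 2 * (((4 * x : ℝ) : ℂ) - z))) / (n ! : ℂ))) z := by fun_prop
  exact (h7.mul (h5.mul h6)).differentiableWithinAt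

/-- Points of the segment have modulus at most 4x and positive real part, so neither the power nor
the exponential produces a ratio |z|/Re z. -/
theorem norm_segmentIntegrand_le (n : ℕ) {x : ℝ} (hx : 0 < x) {s : ℝ} (hs : s ∈ Ioc 0 1) {z : ℂ}
    (hz : z ∈ Metric.ball (x : ℂ) (x / 2)) :
    ‖segmentIntegrand n (4 * x) z s‖ ≤ 4 * ((4 * x) ^ n / (n ! : ℝ)) := by
  obtain ⟨h1, h2, h3, h4⟩ := geometry_of_mem_ball hx hz
  have hs2 : s ^ 2 ≤ 1 := pow_le_one₀ hs.1.le hs.2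
  have h5 : x ≤ ‖2 * z + (s : ℂ) ^ 2 * (((4 * x : ℝ) : ℂ) - z)‖ := by
    refine le_trans ?_ (Complex.re_le_norm _)
    have := re_segment (z := z) 2 (4 * x) s
    push_cast at this ⊢
    rw [this]
    nlinarith [sq_nonneg s]
  have h6 : ‖z + (s : ℂ) ^ 2 * (((4 * x : ℝ) : ℂ) - z)‖ ≤ 4 * x := by
    have e : z + (s : ℂ) ^ 2 * (((4 * x : ℝ) : ℂ) - z) =
        ((1 - s ^ 2 : ℝ) : ℂ) * z + ((s ^ 2 * (4 * x) : ℝ) : ℂ) := by push_cast; ring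
    rw [e]
    refine (norm_add_le _ _).trans ?_
    rw [norm_mul, Complex.norm_real, Complex.norm_real, Real.norm_of_nonneg (by linarith),
      Real.norm_of_nonneg (by positivity)]
    nlinarith [sq_nonneg s, norm_nonneg z]
  have h7 : ‖Complex.exp (-(z + (s : ℂ) ^ 2 * (((4 * x : ℝ) : ℂ) - z)))‖ ≤ 1 := by
    rw [Complex.norm_exp, Real.exp_le_one_iff, Complex.neg_re]
    have := re_segment (z := z) 1 (4 * x) s
    rw [Complex.ofReal_one, one_mul] at this
    rw [this]
    nlinarith [sq_nonneg s]
  have h8 : (4 * x) ^ (1 / 2 : ℝ) * x ^ (-(1 / 2) : ℝ) = 2 := by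
    rw [rpow_neg_half hx.le, ← Real.sqrt_eq_rpow, Real.sqrt_mul (by norm_num),
      show (4 : ℝ) = 2 ^ 2 by norm_num, Real.sqrt_sq (by norm_num)]
    have := Real.sqrt_pos.2 hx
    field_simp
  rw [segmentIntegrand, norm_mul, norm_mul, norm_div, norm_mul, norm_mul, norm_pow,
    Complex.norm_cpow_real, Complex.norm_cpow_real, Complex.norm_natCast, Complex.norm_ofNat]
  calc _ ≤ 2 * ((4 * x) ^ n * 1 / (n ! : ℝ)) *
        ((4 * x) ^ (1 / 2 : ℝ) * x ^ (-(1 / 2) : ℝ)) := by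
        have h9 := Real.rpow_le_rpow_of_nonpos hx h5 (by norm_num : -(1 / 2 : ℝ) ≤ 0)
        gcongr
    _ = _ := by rw [h8]; ring

theorem re_sq_sub_sq_of_mem_ball {x : ℝ} (hx : 0 < x) {y : ℝ} (hy : 4 * x < y) {z : ℂ}
    (hz : z ∈ Metric.ball (x : ℂ) (x / 2)) : (y / 2) ^ 2 ≤ ((y : ℂ) ^ 2 - z ^ 2).re := by
  obtain ⟨h1, h2, -, -⟩ := geometry_of_mem_ball hx hz
  have : ((y : ℂ) ^ 2 - z ^ 2).re = y ^ 2 - (z.re ^ 2 - z.im ^ 2) := by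
    simp [pow_two]
  rw [this]
  nlinarith [sq_nonneg z.im]

theorem differentiableOn_tailIntegrand (n : ℕ) {x : ℝ} (hx : 0 < x) {y : ℝ} (hy : 4 * x < y) :
    DifferentiableOn ℂ (fun z => tailIntegrand n z y) (Metric.ball (x : ℂ) (x / 2)) := by
  intro z hz
  have h1 : (y : ℂ) ^ 2 - z ^ 2 ∈ Complex.slitPlane := by
    left
    refine lt_of_lt_of_le ?_ (re_sq_sub_sq_of_mem_ball hx hy hz)
    have : 0 < y := by linarith
    positivity
  have h2 : DifferentiableAt ℂ (fun z : ℂ => ((y : ℂ) ^ 2 - z ^ 2) ^ ((-(1 / 2) : ℝ) : ℂ)) z :=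
    DifferentiableAt.cpow_const (by fun_prop) h1
  exact (h2.const_mul (poissonWeight n y : ℂ)).differentiableWithinAt

/-- The root contributes at most 2/y, which cancels the y/(n+1) relating consecutive Poisson
weights. -/
theorem norm_tailIntegrand_le (n : ℕ) {x : ℝ} (hx : 0 < x) {y : ℝ} (hy : 4 * x < y) {z : ℂ}
    (hz : z ∈ Metric.ball (x : ℂ) (x / 2)) :
    ‖tailIntegrand (n + 1) z y‖ ≤ 2 / ((n : ℝ) + 1) * poissonWeight n y := by
  have hy0 : 0 < y := by linarith
  have h1 : (y / 2) ^ 2 ≤ ‖(y : ℂ) ^ 2 - z ^ 2‖ :=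
    (re_sq_sub_sq_of_mem_ball hx hy hz).trans (Complex.re_le_norm _)
  have h2 : ‖(y : ℂ) ^ 2 - z ^ 2‖ ^ (-(1 / 2) : ℝ) ≤ 2 / y := by
    refine (Real.rpow_le_rpow_of_nonpos (by positivity) h1 (by norm_num)).trans_eq ?_
    rw [rpow_neg_half (by positivity), Real.sqrt_sq (by positivity), inv_div]
  have h3 := poissonWeight_nonneg n hy0.le
  rw [tailIntegrand, norm_mul, Complex.norm_cpow_real, Complex.norm_real,
    Real.norm_of_nonneg (poissonWeight_nonneg _ hy0.le), poissonWeight_succ]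
  calc _ ≤ y / ((n : ℝ) + 1) * poissonWeight n y * (2 / y) := by gcongr
    _ = _ := by field_simp

/-- As e < 3, y lies below n/e, and (n/e)ⁿ/n! is the peak of the Poisson weight. -/
theorem pow_div_factorial_le_of_small {n : ℕ} {y : ℝ} (hy : 0 ≤ y) (h : 3 * y ≤ n) :
    y ^ n / (n ! : ℝ) ≤ 1 / √((n : ℝ) + 1) := by
  refine le_trans ?_ (poissonWeight_le n (n.cast_nonneg (α := ℝ)))
  rw [poissonWeight]
  have h1 : y ≤ n * Real.exp (-1) := by
    rw [Real.exp_neg, ← div_eq_mul_inv, le_div_iff₀ (Real.exp_pos 1)]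
    nlinarith [Real.exp_one_lt_d9]
  have h2 : (n : ℝ) ^ n * Real.exp (-n) = (n * Real.exp (-1)) ^ n := by
    rw [mul_pow, ← Real.exp_nat_mul]
    congr 2
    ring
  rw [h2]
  gcongr

theorem small_argument_estimate {n : ℕ} (m : ℕ) {x : ℝ} (hx : 0 < x) (hxn : 12 * x ≤ n) :
    |iteratedDeriv m (omegaTilde n) x| ≤ (m ! : ℝ) * (4 / x) ^ m * (8 / √((n : ℝ) + 1)) := by
  have hn : n ≠ 0 := by rintro rfl; norm_num at hxn; linarith
  obtain ⟨k, rfl⟩ := Nat.exists_eq_succ_of_ne_zero hn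
  have hball : IsOpen (Metric.ball (x : ℂ) (x / 2)) := Metric.isOpen_ball
  have hseg : DifferentiableOn ℂ
      (fun z => ∫ s in Ioc (0 : ℝ) 1, segmentIntegrand (k + 1) (4 * x) z s)
      (Metric.ball (x : ℂ) (x / 2)) := by
    refine differentiableOn_integral_of_dominated hball
      (integrableOn_const (C := 4 * ((4 * x) ^ (k + 1) / ((k + 1)! : ℝ))) (by simp))
      (fun z _ => ?_) ?_ ?_
    · unfold segmentIntegrand
      exact Measurable.aestronglyMeasurable (by fun_prop)
    · exact Eventually.of_forall fun s => differentiableOn_segmentIntegrand _ hx s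
    · exact (ae_restrict_mem measurableSet_Ioc).mono fun s hs z hz =>
        norm_segmentIntegrand_le _ hx hs hz
  have htailint : IntegrableOn (fun y => 2 / ((k : ℝ) + 1) * poissonWeight k y) (Ioi (4 * x)) :=
    (integrableOn_poissonWeight k (by positivity)).const_mul _
  have htail : DifferentiableOn ℂ (fun z => ∫ y in Ioi (4 * x), tailIntegrand (k + 1) z y)
      (Metric.ball (x : ℂ) (x / 2)) := by
    refine differentiableOn_integral_of_dominated hball htailint (fun z _ => ?_) ?_ ?_
    · have h1 := (continuous_poissonWeight (k + 1)).measurable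
      unfold tailIntegrand
      exact Measurable.aestronglyMeasurable (by fun_prop)
    · exact (ae_restrict_mem measurableSet_Ioi).mono fun y hy =>
        differentiableOn_tailIntegrand _ hx hy
    · exact (ae_restrict_mem measurableSet_Ioi).mono fun y hy z hz =>
        norm_tailIntegrand_le _ hx hy hz
  -- Segment and tail contribute 4/√(n+1) each. The integrals keep 4x fixed at the centre of the
  -- disc, and represent ω̃ₙ at every real point y of it because y < 4x.
  refine (abs_iteratedDeriv_le_of_holomorphic (C := 8 / √(((k + 1 : ℕ) : ℝ) + 1)) (half_pos hx)
    (hseg.add htail) (fun z hz => ?_) (fun y hy => ?_) m).trans_eq ?_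
  · have h1 : ‖∫ s in Ioc (0 : ℝ) 1, segmentIntegrand (k + 1) (4 * x) z s‖ ≤
        4 * (1 / √(((k + 1 : ℕ) : ℝ) + 1)) := by
      have := norm_setIntegral_le_of_norm_le_const (μ := volume) (s := Ioc (0 : ℝ) 1)
        (C := 4 * ((4 * x) ^ (k + 1) / ((k + 1)! : ℝ))) (by simp)
        (fun s hs => norm_segmentIntegrand_le (k + 1) hx hs hz)
      refine this.trans ?_
      simp only [Real.volume_real_Ioc, sub_zero, max_eq_left zero_le_one, mul_one]
      exact mul_le_mul_of_nonneg_left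
        (pow_div_factorial_le_of_small (by positivity) (by linarith)) (by norm_num)
    have h2 : ‖∫ y in Ioi (4 * x), tailIntegrand (k + 1) z y‖ ≤ 2 / ((k : ℝ) + 1) * 1 := by
      refine (norm_integral_le_of_norm_le htailint
        ((ae_restrict_mem measurableSet_Ioi).mono fun y hy =>
          norm_tailIntegrand_le _ hx hy hz)).trans ?_
      rw [integral_const_mul]
      gcongr
      exact integral_poissonWeight_Ioi_le k (by positivity)
    have h3 : 2 / ((k : ℝ) + 1) ≤ 4 / √(((k + 1 : ℕ) : ℝ) + 1) := by
      rw [div_le_div_iff₀ (by positivity) (by positivity)]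
      have hk := k.cast_nonneg (α := ℝ)
      have : √(((k + 1 : ℕ) : ℝ) + 1) ≤ (k : ℝ) + 2 := by
        rw [Real.sqrt_le_left (by positivity)]
        push_cast
        nlinarith
      linarith
    calc _ ≤ 4 * (1 / √(((k + 1 : ℕ) : ℝ) + 1)) + 4 / √(((k + 1 : ℕ) : ℝ) + 1) :=
          (norm_add_le _ _).trans (add_le_add h1 (by linarith))
      _ = _ := by ring
  · obtain ⟨h1, h2, -, -⟩ := geometry_of_mem_ball hx hy
    rw [Complex.ofReal_re] at h1 h2
    exact omegaTilde_eq_re_integral _ (by linarith) (by linarith)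
  · rw [show (4 / x) ^ m = ((x / 2 / 2) ^ m)⁻¹ by rw [← inv_pow]; congr 1; field_simp; norm_num]
    ring

/-! ### Assembly of the estimates. -/

theorem mainTheorem1 :
    -- all derivatives occurring below exist
    (∀ n : ℕ, ContDiffOn ℝ ∞ (omegaTilde n) (Set.Ioi 0)) ∧
    -- general estimate
    (∃ γ : ℝ, 1 ≤ γ ∧ ∀ (n m : ℕ) (x : ℝ), 0 < x →
      |iteratedDeriv m (omegaTilde n) x| ≤
        (m ! : ℝ) * (γ * √((n : ℝ) + 1) / x) ^ m *
          (kroneckerDelta m 0 / √(2 * x + 1) +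
            γ / √((n : ℝ) + 1) *
              (1 + kroneckerDelta (m + n) 0 * Real.log ((x + 1) / x)))) ∧
    -- refined estimate for small arguments
    (∀ C : ℝ, 1 < C → ∃ γ : ℝ, 1 < γ ∧ ∀ (n m : ℕ) (x : ℝ),
      (m : ℝ) ≤ √(n : ℝ) * ((C - 1) / C) →
      2 * ((⌊(m : ℝ) * Real.log ((n : ℝ) + 1) / (4 * Real.log 2)⌋ : ℤ) : ℝ) - 2 ≤
        ((n : ℝ) - 1) / 2 →
      0 < x → x ≤ min ((n : ℝ) / (2 * C)) (((n : ℝ) + 1) / (4 * γ)) →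
      |iteratedDeriv m (omegaTilde n) x| ≤
        (m ! : ℝ) * (γ / x) ^ m *
          (kroneckerDelta m 0 / √(2 * x + 1) +
            γ / √((n : ℝ) + 1) *
              (1 + kroneckerDelta (n + m) 0 * Real.log ((x + 1) / x)))) ∧
    -- refined estimate for large arguments
    (∃ γ : ℝ, 1 ≤ γ ∧ ∀ (n m : ℕ) (x : ℝ),
      1 + 2 * Real.log ((n : ℝ) + 1) ≤ (m : ℝ) →
      (if n ≤ 1 then 0 else (n : ℝ) + (m : ℝ) * (√(n : ℝ) + 2)) < x →
      |iteratedDeriv m (omegaTilde n) x| ≤ (m ! : ℝ) * (γ / x) ^ m) ∧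
    -- exponential decay
    (∀ (n : ℕ) (x : ℝ), max 1 ((n : ℝ) + √(n : ℝ)) ≤ x →
      |omegaTilde n x| ≤
        3 * (Real.exp (√(n : ℝ) - x / (1 + √(n : ℝ))) / √((n : ℝ) + 1))) := by
  refine ⟨contDiffOn_omegaTilde, ⟨12, by norm_num, fun n m x hx => general_estimate n m hx⟩,
    fun C hC => ⟨100, by norm_num, fun n m x _ _ hx hxn => ?_⟩,
    ⟨400, by norm_num, fun n m x hm hx => large_argument_estimate hm hx⟩,
    fun n x hx => exponential_decay n hx⟩
  have h1 := hxn.trans (min_le_left _ _)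
  have h2 := hxn.trans (min_le_right _ _)
  -- The bound x ≤ n/(2C) excludes n = 0; then x ≤ (n+1)/400 gives 12x ≤ n, so γ = 100 serves every
  -- C.
  have hn : n ≠ 0 := by
    rintro rfl
    rw [Nat.cast_zero, zero_div] at h1
    linarith
  have hn' : (1 : ℝ) ≤ n := by exact_mod_cast Nat.one_le_iff_ne_zero.2 hn
  have hlog := mul_nonneg (kroneckerDelta_nonneg (n + m) 0) (log_div_nonneg hx)
  have hk := kroneckerDelta_nonneg m 0
  have h3 : 8 / √((n : ℝ) + 1) ≤ kroneckerDelta m 0 / √(2 * x + 1) + 100 / √((n : ℝ) + 1) *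
      (1 + kroneckerDelta (n + m) 0 * Real.log ((x + 1) / x)) := by
    calc 8 / √((n : ℝ) + 1) ≤ 0 + 100 / √((n : ℝ) + 1) * (1 + 0) := by
          rw [add_zero, mul_one, zero_add]; gcongr; norm_num
      _ ≤ _ := by gcongr; positivity
  refine (small_argument_estimate m hx (by linarith)).trans ?_
  gcongr
  norm_num
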